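/- **Theorem 7.1** (necessary optimality conditions for semi-infinite programs with set constraints). Let $\mathcal T$ be a metric space and let $M\colon\mathcal T\rightrightarrows\mathbb R^n$ be a set-valued mapping with closed values that is outer semicontinuous: if $t_k\to t$ in $\mathcal T$, $y_k\in M(t_k)$ and $y_k\to y$, then $y\in M(t)$. Let $h\colon\mathbb R^n\to(-\infty,\infty]$, and let $\bar x$ be a local minimizer of the problem $$\text{minimize } h(x)\ \text{ subject to }\ x\in M(t)\ \text{ for all } t\in\mathcal T,$$ where $h$ is finite and Lipschitz continuous on a neighbourhood of $\bar x$. *Notation.* For $\Theta\subset\mathbb R^n$ and $x\in\Theta$: - $T(x;\Theta)$ is the set of all limits $w=\lim w_k$ for which there are $\tau_k\downarrow0$ with $x+\tau_kw_k\in\Theta$ for all $k$ (contingent cone). - $\widehat N(x;\Theta)$ is the set of all $v$ with $\limsup_{y\to x,\;y\in\Theta\setminus\{x\}}\langle v,y-x\rangle/\|y-x\|\le0$ (regular normal cone). - $N(x;\Theta)$ is the set of all limits $v=\lim v_k$ with $v_k\in\widehat N(x_k;\Theta)$, $x_k\in\Theta$, $x_k\to x$ (limiting normal cone). - $\Theta$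 is normally regular at $x$ if $\widehat N(x;\Theta)=N(x;\Theta)$. The limiting subdifferential of $h$ at a point $x$ with $h(x)<\infty$ is $\partial h(x)=\{v\in\mathbb R^n : (v,-1)\in N((x,h(x));\operatorname{epi}h)\}$, where $\operatorname{epi}h=\{(x,\alpha)\in\mathbb R^{n+1} : \alpha\ge h(x)\}$. For a Borel measure $\nu$ on $\mathcal T$ and $F\colon\mathcal T\rightrightarrows\mathbb R^n$, the Aumann integral $\int_{\mathcal T}F\,d\nu$ is the set of all integrals $\int_{\mathcal T}f\,d\nu$ with $f\in L^1(\nu;\mathbb R^n)$ and $f(t)\in F(t)$ for $\nu$-a.e. $t$. Let $\mathfrak M_+(\mathcal T)$ be the set of all finite Borel measures on $\mathcal T$ that give every nonempty open set positive measure. **(i)** Assume that $\bigcap_{t\in\mathcal T}M(t)$ is normally regular at $\bar x$ and that for every dense set $A\subset\mathcal T$ $$T\Big(\bar x;\bigcap_{t\in A}M(t)\Big)=\bigcap_{t\in A}T\big(\bar x;M(t)\big)\qquad\text{(CHIP)}.$$ Then for every $\nu\in\mathfrak M_+(\mathcal T)$ $$0\in\partial h(\bar x)+\mathrm{cl}\Big(\int_{\mathcal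 T}N\big(\bar x;M(t)\big)\,d\nu(t)\Big).$$ **(ii)** Assume instead that $M(t)$ is a cone (invariant under multiplication by positive scalars) for every $t\in\mathcal T$ and that $\bar x=0$. Then for every $\nu\in\mathfrak M_+(\mathcal T)$ $$0\in\partial h(0)+\mathrm{cl}\Big(\int_{\mathcal T}N\big(0;M(t)\big)\,d\nu(t)\Big).$$ -/

import Mathlib

open Filter Topology MeasureTheory
open scoped Pointwise InnerProductSpace NNReal

namespace SemiInfinite

/-- The sequential (Painlevé–Kuratowski) outer limit of a set-valued mapping `F` along a filter:
all limits of sequences `y k ∈ F (x k)` with `x k` tending to the filter. -/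
def outerLimit {X Y : Type*} [TopologicalSpace Y] (F : X → Set Y) (l : Filter X) : Set Y :=
  {y | ∃ (u : ℕ → X) (w : ℕ → Y),
    Tendsto u atTop l ∧ Tendsto w atTop (𝓝 y) ∧ ∀ k, w k ∈ F (u k)}

/-- `M` is outer semicontinuous if the outer limit of `M s` as `s → t` lies in `M t`,
for every `t`. -/
def IsOuterSemicontinuous {X Y : Type*} [TopologicalSpace X] [TopologicalSpace Y]
    (M : X → Set Y) : Prop :=
  ∀ t, outerLimit M (𝓝 t) ⊆ M t

section Cones

variable {E : Type*} [NormedAddCommGroup E] [InnerProductSpace ℝ E]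

/-- The Bouligand–Severi contingent cone to `Θ` at `x`: the outer limit of `(Θ - x) / τ`
as `τ ↓ 0`. -/
def tangentCone (x : E) (Θ : Set E) : Set E :=
  outerLimit (fun τ : ℝ => {w : E | x + τ • w ∈ Θ}) (𝓝[>] 0)

/-- The regular (Fréchet) normal cone: all `v` such that the upper limit of
`⟪v, y - x⟫ / ‖y - x‖` as `y → x`, `y ∈ Θ`, `y ≠ x`, is at most `0`. -/
def regularNormalCone (x : E) (Θ : Set E) : Set E :=
  {v | ∀ ε : ℝ, 0 < ε → ∀ᶠ y in 𝓝[Θ] x, ⟪v, y - x⟫_ℝ ≤ ε * ‖y - x‖}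

/-- The limiting (Mordukhovich) normal cone: the outer limit of the regular normal cones at `y`
as `y → x` within `Θ`. -/
def normalCone (x : E) (Θ : Set E) : Set E :=
  outerLimit (fun y => regularNormalCone y Θ) (𝓝[Θ] x)

/-- `Θ` is normally regular at `x` if its regular and limiting normal cones at `x` coincide. -/
def IsNormallyRegularAt (x : E) (Θ : Set E) : Prop :=
  regularNormalCone x Θ = normalCone x Θ

/-- Invariance under multiplication by positive scalars. -/
def IsCone (K : Set E) : Prop :=
  ∀ x ∈ K, ∀ c : ℝ, 0 < c → c • x ∈ K

/-- The epigraph of `h : E → (-∞, ∞]`, as a subset of `E × ℝ` with its Euclidean structure. -/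
def epigraph (h : E → WithTop ℝ) : Set (WithLp 2 (E × ℝ)) :=
  {p | h p.fst ≤ (p.snd : WithTop ℝ)}

/-- The limiting (Mordukhovich) subdifferential of `h` at a point `x` of its domain: all `v` with
`(v, -1)` a limiting normal to the epigraph at `(x, h x)`. It is empty where `h x = ∞`. -/
def subdifferential (h : E → WithTop ℝ) (x : E) : Set E :=
  {v | ∃ α : ℝ, h x = (α : WithTop ℝ) ∧
    WithLp.toLp 2 (v, (-1 : ℝ)) ∈ normalCone (WithLp.toLp 2 (x, α)) (epigraph h)}

/-- `h : E → (-∞, ∞]` is locally Lipschitzian around `x`: on a neighbourhood of `x` it is finite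
and Lipschitz continuous. -/
def IsLipschitzAround (h : E → WithTop ℝ) (x : E) : Prop :=
  ∃ U ∈ 𝓝 x, ∃ (g : E → ℝ) (K : ℝ≥0),
    LipschitzOnWith K g U ∧ ∀ y ∈ U, h y = (g y : WithTop ℝ)

/-- The Aumann integral of a set-valued mapping: the integrals of its integrable a.e. selections. -/
def aumannIntegral {T : Type*} [MeasurableSpace T] (F : T → Set E) (ν : Measure T) : Set E :=
  {v | ∃ f : T → E, Integrable f ν ∧ (∀ᵐ t ∂ν, f t ∈ F t) ∧ ∫ t, f t ∂ν = v}

end Cones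


/-- At points of the set, the contingent cone is Mathlib's positive tangent cone. -/
theorem tangentCone_eq_posTangentConeAt {E : Type*} [NormedAddCommGroup E] [InnerProductSpace ℝ E]
    {x : E} {Θ : Set E} (hx : x ∈ Θ) : tangentCone x Θ = posTangentConeAt Θ x := by
  ext y
  rw [mem_tangentConeAt_iff_exists_seq]
  constructor
  · rintro ⟨u, w, hu, hw, hm⟩
    rw [tendsto_nhdsWithin_iff] at hu
    refine ⟨fun k => (u k)⁻¹.toNNReal, fun k => u k • w k, ?_, Eventually.of_forall hm, ?_⟩
    · simpa using hu.1.smul hw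
    · refine hw.congr' ?_
      filter_upwards [hu.2] with k hk
      have hk' : 0 < u k := hk
      rw [NNReal.smul_def, Real.coe_toNNReal _ (inv_nonneg.2 hk'.le), inv_smul_smul₀ hk'.ne']
  · rintro ⟨c, d, hd, hm, hc⟩
    by_cases hy : y = 0
    · subst hy
      refine ⟨fun k => 1 / ((k : ℝ) + 1), fun _ => 0, ?_, tendsto_const_nhds, ?_⟩
      · rw [tendsto_nhdsWithin_iff]
        exact ⟨tendsto_one_div_add_atTop_nhds_zero_nat, Eventually.of_forall fun k => by
          simp only [Set.mem_Ioi]; positivity⟩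
      · intro k; simpa using hx
    · have hne : ∀ᶠ k in atTop, c k • d k ≠ 0 := hc.eventually_ne hy
      have hpos : ∀ᶠ k in atTop, 0 < (c k : ℝ) := by
        filter_upwards [hne] with k hk
        have : c k ≠ 0 := fun h => hk (by simp [h])
        exact_mod_cast pos_iff_ne_zero.2 this
      have hlim : Tendsto (fun k => ((c k : ℝ))⁻¹) atTop (𝓝 0) := by
        have h1 : Tendsto (fun k => ‖d k‖ / ‖c k • d k‖) atTop (𝓝 (‖(0 : E)‖ / ‖y‖)) :=
          hd.norm.div hc.norm (norm_ne_zero_iff.2 hy)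
        rw [norm_zero, zero_div] at h1
        refine h1.congr' ?_
        filter_upwards [hne, hpos] with k hk hk'
        have hdk : ‖d k‖ ≠ 0 := fun h => hk (by simp [norm_eq_zero.1 h])
        rw [NNReal.smul_def, norm_smul, Real.norm_of_nonneg hk'.le]
        field_simp
      obtain ⟨N, hN⟩ := eventually_atTop.1 (hm.and hpos)
      refine ⟨fun k => ((c (k + N) : ℝ))⁻¹, fun k => c (k + N) • d (k + N), ?_,
        hc.comp (tendsto_add_atTop_nat N), fun k => ?_⟩
      · rw [tendsto_nhdsWithin_iff]
        exact ⟨hlim.comp (tendsto_add_atTop_nat N), Eventually.of_forall fun k =>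
          inv_pos.2 (hN (k + N) (by omega)).2⟩
      · have h := hN (k + N) (by omega)
        simp only [Set.mem_ofPred_eq]
        rw [NNReal.smul_def, inv_smul_smul₀ h.2.ne']
        exact h.1

end SemiInfinite

namespace SemiInfinite

/-! Penalization at the minimizer yields `w ∈ ∂h(x̄)` such that `-w` is a limit of proximal normals
`u k` to `Ω = ⋂ M t` at points `z k → x̄`. It remains to express `-w` through integrals of normals
to the individual sets.

The engine is `mem_closure_aumannIntegral_of_ae_imp`. For `v` proximally normal at `z` to the a.e.
intersection of closed sets `F t`, minimize `-⟪v, x - z⟫ + (C + 1)‖x - z‖² + (k + 1) ∫ d(x, F t)²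
dν`. The minimizers `x k` subconverge to `z`. Each squared distance is majorized by a quadratic
touching at `x k`, with slope given by any projection `y t`, while minimality minorizes the
integral; the slopes must match, so `v - 2(C + 1)(x k - z)` is the integral of the proximal normals
`2(k + 1)(x k - y t)`. The same squeeze makes `y` a.e. measurable, so no measurable selection is
needed.

A conull set of indices is dense, so outer semicontinuity turns the a.e. intersection into the full
one. In (i), `F t` is the contingent cone at `x̄`, with CHIP and normal regularity giving the
hypothesis at `z = 0`, `C = 0`; in (ii), `F t = M t` and `z = z k`. In both cases proximal normals
to `F t` are limiting normals to `M t` at `x̄`. -/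

/-- Measurability of `φ` is a conclusion: `⨆ l m` and `⨅ u m` are measurable, enclose `φ` and have
equal integrals, hence agree almost everywhere. -/
theorem integrable_and_integral_eq_of_squeeze {T : Type*} [MeasurableSpace T] {ν : Measure T}
    {φ : T → ℝ} {l u : ℕ → T → ℝ} {A : ℝ} {c : ℕ → ℝ}
    (hlm : ∀ m, Measurable (l m)) (hum : ∀ m, Measurable (u m))
    (hli : ∀ m, Integrable (l m) ν) (hui : ∀ m, Integrable (u m) ν)
    (hl : ∀ m t, l m t ≤ φ t) (hu : ∀ m t, φ t ≤ u m t)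
    (hlA : ∀ m, A - c m ≤ ∫ t, l m t ∂ν) (huA : ∀ m, ∫ t, u m t ∂ν ≤ A + c m)
    (hc : Tendsto c atTop (𝓝 0)) :
    Integrable φ ν ∧ ∫ t, φ t ∂ν = A := by
  have hbl : ∀ t, BddAbove (Set.range fun m => l m t) := fun t =>
    ⟨φ t, by rintro _ ⟨m, rfl⟩; exact hl m t⟩
  have hbu : ∀ t, BddBelow (Set.range fun m => u m t) := fun t =>
    ⟨φ t, by rintro _ ⟨m, rfl⟩; exact hu m t⟩
  set L : T → ℝ := fun t => ⨆ m, l m t with hL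
  set U : T → ℝ := fun t => ⨅ m, u m t with hU
  have hlL : ∀ m t, l m t ≤ L t := fun m t => le_ciSup (hbl t) m
  have hUu : ∀ m t, U t ≤ u m t := fun m t => ciInf_le (hbu t) m
  have hLφ : ∀ t, L t ≤ φ t := fun t => ciSup_le fun m => hl m t
  have hφU : ∀ t, φ t ≤ U t := fun t => le_ciInf fun m => hu m t
  have hLi : Integrable L ν := by
    refine ((hli 0).abs.add (hui 0).abs).mono' (Measurable.iSup hlm).aestronglyMeasurable
      (Eventually.of_forall fun t => ?_)
    have h1 := hlL 0 t
    have h2 := (hLφ t).trans (hu 0 t)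
    rw [Real.norm_eq_abs, abs_le]
    simp only [Pi.add_apply]
    constructor <;> cases abs_cases (l 0 t) <;> cases abs_cases (u 0 t) <;> linarith
  have hUi : Integrable U ν := by
    refine ((hli 0).abs.add (hui 0).abs).mono' (Measurable.iInf hum).aestronglyMeasurable
      (Eventually.of_forall fun t => ?_)
    have h1 := (hl 0 t).trans (hφU t)
    have h2 := hUu 0 t
    rw [Real.norm_eq_abs, abs_le]
    simp only [Pi.add_apply]
    constructor <;> cases abs_cases (l 0 t) <;> cases abs_cases (u 0 t) <;> linarith
  have hLU : ∀ t, 0 ≤ (U - L) t := fun t => sub_nonneg.2 ((hLφ t).trans (hφU t))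
  have hle : ∀ m, ∫ t, (U - L) t ∂ν ≤ 2 * c m := by
    intro m
    have h1 : ∫ t, (U - L) t ∂ν ≤ ∫ t, (u m - l m) t ∂ν :=
      integral_mono (hUi.sub hLi) ((hui m).sub (hli m))
        fun t => sub_le_sub (hUu m t) (hlL m t)
    have h2 : ∫ t, (u m - l m) t ∂ν = ∫ t, u m t ∂ν - ∫ t, l m t ∂ν :=
      integral_sub (hui m) (hli m)
    have := hlA m
    have := huA m
    linarith
  have h0 : ∫ t, (U - L) t ∂ν = 0 := by
    refine le_antisymm ?_ (integral_nonneg hLU)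
    exact ge_of_tendsto' (by simpa using hc.const_mul 2) hle
  have hae : U - L =ᵐ[ν] 0 := (integral_eq_zero_iff_of_nonneg hLU (hUi.sub hLi)).1 h0
  have hφL : L =ᵐ[ν] φ := by
    filter_upwards [hae] with t ht
    have ht' : U t - L t = 0 := ht
    have := hLφ t
    have := hφU t
    linarith
  have hφi : Integrable φ ν := hLi.congr hφL
  refine ⟨hφi, le_antisymm ?_ ?_⟩
  · have : ∀ m, ∫ t, φ t ∂ν ≤ A + c m := fun m =>
      (integral_mono hφi (hui m) (hu m)).trans (huA m)
    exact ge_of_tendsto' (by simpa using hc.const_add A) this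
  · have : ∀ m, A - c m ≤ ∫ t, φ t ∂ν := fun m =>
      (hlA m).trans (integral_mono (hli m) hφi (hl m))
    exact le_of_tendsto' (by simpa using hc.const_sub A) this

/-! ### Integrals of squared distances -/

section Distance

variable {E : Type*} [NormedAddCommGroup E] {T : Type*} [MeasurableSpace T] {ν : Measure T}
  {F : T → Set E} {z : E}

theorem integrable_infDist_sq [IsFiniteMeasure ν]
    (hF : ∀ x, Measurable fun t => Metric.infDist x (F t)) (hz : ∀ t, z ∈ F t) (x : E) :
    Integrable (fun t => Metric.infDist x (F t) ^ 2) ν := by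
  refine (integrable_const (dist x z ^ 2)).mono' ((hF x).pow_const 2).aestronglyMeasurable
    (Eventually.of_forall fun t => ?_)
  rw [Real.norm_of_nonneg (by positivity)]
  exact pow_le_pow_left₀ Metric.infDist_nonneg (Metric.infDist_le_dist_of_mem (hz t)) 2

theorem continuous_integral_infDist_sq [IsFiniteMeasure ν]
    (hF : ∀ x, Measurable fun t => Metric.infDist x (F t)) (hz : ∀ t, z ∈ F t) :
    Continuous fun x => ∫ t, Metric.infDist x (F t) ^ 2 ∂ν := by
  refine continuous_iff_continuousAt.2 fun x => ?_
  refine continuousAt_of_dominated (bound := fun _ => (dist x z + 1) ^ 2)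
    (Eventually.of_forall fun y => ((hF y).pow_const 2).aestronglyMeasurable) ?_
    (integrable_const _) (Eventually.of_forall fun t =>
      ((Metric.continuous_infDist_pt (F t)).pow 2).continuousAt)
  filter_upwards [Metric.ball_mem_nhds x one_pos] with y hy
  refine Eventually.of_forall fun t => ?_
  rw [Real.norm_of_nonneg (by positivity)]
  refine pow_le_pow_left₀ Metric.infDist_nonneg
    ((Metric.infDist_le_dist_of_mem (hz t)).trans ?_) 2
  have := dist_triangle y x z
  rw [Metric.mem_ball] at hy
  linarith

end Distance

/-! ### Projections and integrals of proximal normals -/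

section Projection

variable {E : Type*} [NormedAddCommGroup E] [InnerProductSpace ℝ E]

/-- Testing with the fixed point `y` gives the upper half of differentiability of the squared
distance; the lower half will come from minimality. -/
theorem infDist_add_sq_le {F : Set E} {x y : E} (hy : y ∈ F)
    (hxy : Metric.infDist x F = ‖x - y‖) (d : E) :
    Metric.infDist (x + d) F ^ 2 ≤ Metric.infDist x F ^ 2 + 2 * ⟪d, x - y⟫_ℝ + ‖d‖ ^ 2 := by
  have h1 : Metric.infDist (x + d) F ≤ ‖(x - y) + d‖ := by
    have := Metric.infDist_le_dist_of_mem (x := x + d) hy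
    rwa [dist_eq_norm, add_sub_right_comm] at this
  have h2 := pow_le_pow_left₀ Metric.infDist_nonneg h1 2
  rw [norm_add_sq_real, real_inner_comm] at h2
  rwa [hxy]

variable {T : Type*} [MeasurableSpace T] {ν : Measure T} {F : T → Set E} {z : E}

/-- If the integral of the squared distances has a quadratic minorant at `x₀`, then any choice of
projections of `x₀` is integrable, and the minorant has slope the integral of the residuals. -/
theorem integrable_residual_and_integral_eq [FiniteDimensional ℝ E] [IsFiniteMeasure ν]
    (hF : ∀ x, Measurable fun t => Metric.infDist x (F t)) (hz : ∀ t, z ∈ F t)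
    {x₀ a : E} {C : ℝ} {y : T → E} (hy : ∀ t, y t ∈ F t)
    (hxy : ∀ t, Metric.infDist x₀ (F t) = ‖x₀ - y t‖)
    (hmin : ∀ d, ∫ t, Metric.infDist x₀ (F t) ^ 2 ∂ν + 2 * ⟪d, a⟫_ℝ - C * ‖d‖ ^ 2 ≤
      ∫ t, Metric.infDist (x₀ + d) (F t) ^ 2 ∂ν) :
    Integrable (fun t => x₀ - y t) ν ∧ ∫ t, (x₀ - y t) ∂ν = a := by
  let s : ℕ → ℝ := fun m => 1 / ((m : ℝ) + 1)
  have hs : ∀ m, 0 < s m := fun m => by positivity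
  -- Half the difference quotient in direction `e`, lowered by the quadratic error so that it lies
  -- below `⟪e, x₀ - y t⟫`. Direction `-e` supplies the upper bounds.
  let l : E → ℕ → T → ℝ := fun e m t =>
    (Metric.infDist (x₀ + s m • e) (F t) ^ 2 - Metric.infDist x₀ (F t) ^ 2) / (2 * s m)
      - s m * ‖e‖ ^ 2 / 2
  have hlm : ∀ e m, Measurable (l e m) := fun e m =>
    ((((hF _).pow_const 2).sub ((hF _).pow_const 2)).div_const _).sub_const _
  have hli' : ∀ e m, Integrable (fun t =>
      (Metric.infDist (x₀ + s m • e) (F t) ^ 2 - Metric.infDist x₀ (F t) ^ 2) / (2 * s m)) ν :=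
    fun e m => ((integrable_infDist_sq hF hz _).sub (integrable_infDist_sq hF hz _)).div_const _
  have hli : ∀ e m, Integrable (l e m) ν := fun e m => (hli' e m).sub (integrable_const _)
  have hl : ∀ e m t, l e m t ≤ ⟪e, x₀ - y t⟫_ℝ := by
    intro e m t
    have h := infDist_add_sq_le (hy t) (hxy t) (s m • e)
    rw [real_inner_smul_left, norm_smul, Real.norm_of_nonneg (hs m).le, mul_pow] at h
    have h2 := hs m
    simp only [l]
    rw [sub_le_iff_le_add, div_le_iff₀ (by positivity)]
    nlinarith
  have hI : ∀ e m, ⟪e, a⟫_ℝ - s m * ((C + ν.real Set.univ) * ‖e‖ ^ 2 / 2) ≤ ∫ t, l e m t ∂ν := by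
    intro e m
    have h := hmin (s m • e)
    have h2 := hs m
    rw [real_inner_smul_left, norm_smul, Real.norm_of_nonneg (hs m).le, mul_pow] at h
    simp only [l]
    rw [integral_sub (hli' e m) (integrable_const _), integral_div,
      integral_sub (integrable_infDist_sq hF hz _) (integrable_infDist_sq hF hz _),
      integral_const, smul_eq_mul]
    have h3 : ⟪e, a⟫_ℝ - s m * C * ‖e‖ ^ 2 / 2 ≤
        (∫ t, Metric.infDist (x₀ + s m • e) (F t) ^ 2 ∂ν -
          ∫ t, Metric.infDist x₀ (F t) ^ 2 ∂ν) / (2 * s m) := by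
      rw [le_div_iff₀ (by positivity)]
      nlinarith
    linarith
  have hc : ∀ e : E, Tendsto (fun m => s m * ((C + ν.real Set.univ) * ‖e‖ ^ 2 / 2)) atTop (𝓝 0) :=
    fun e => by
      simpa [s] using (tendsto_one_div_add_atTop_nhds_zero_nat (𝕜 := ℝ)).mul_const
        ((C + ν.real Set.univ) * ‖e‖ ^ 2 / 2)
  have key : ∀ e, Integrable (fun t => ⟪e, x₀ - y t⟫_ℝ) ν ∧
      ∫ t, ⟪e, x₀ - y t⟫_ℝ ∂ν = ⟪e, a⟫_ℝ := by
    intro e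
    refine integrable_and_integral_eq_of_squeeze (l := l e) (u := fun m t => - l (-e) m t)
      (hlm e) (fun m => (hlm (-e) m).neg) (hli e) (fun m => (hli (-e) m).neg) (hl e) ?_ (hI e) ?_
      (hc e)
    · intro m t
      have := hl (-e) m t
      rw [inner_neg_left] at this
      linarith
    · intro m
      have := hI (-e) m
      rw [inner_neg_left, norm_neg] at this
      rw [integral_neg]
      linarith
  have hint : Integrable (fun t => x₀ - y t) ν := by
    let b := stdOrthonormalBasis ℝ E
    have : (fun t => x₀ - y t) = fun t => ∑ i, ⟪b i, x₀ - y t⟫_ℝ • b i := by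
      funext t
      exact (b.sum_repr' _).symm
    rw [this]
    exact integrable_finsetSum _ fun i _ => (key (b i)).1.smul_const _
  refine ⟨hint, ext_inner_left ℝ fun e => ?_⟩
  rw [← (key e).2]
  exact (integral_inner hint e).symm

/-- A vector that is, up to a quadratic term, normal at `z` to the almost sure intersection of the
sets `F t` is a limit of integrals of proximal normals to these sets. -/
theorem mem_closure_aumannIntegral_of_ae_imp [FiniteDimensional ℝ E] [IsFiniteMeasure ν]
    (hFc : ∀ t, IsClosed (F t))
    (hF : ∀ x, Measurable fun t => Metric.infDist x (F t)) (hz : ∀ t, z ∈ F t)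
    {N : T → Set E}
    (hN : ∀ t x y, y ∈ F t → Metric.infDist x (F t) = ‖x - y‖ → ∀ c : ℝ, 0 < c → c • (x - y) ∈ N t)
    {v : E} {C : ℝ} (hC : 0 ≤ C)
    (hv : ∀ x, (∀ᵐ t ∂ν, x ∈ F t) → ⟪v, x - z⟫_ℝ ≤ C * ‖x - z‖ ^ 2) :
    v ∈ closure (aumannIntegral N ν) := by
  have : ProperSpace E := FiniteDimensional.proper ℝ E
  have hproj : ∀ x t, ∃ y ∈ F t, Metric.infDist x (F t) = ‖x - y‖ := fun x t => by
    simpa only [dist_eq_norm] using (hFc t).exists_infDist_eq_dist ⟨z, hz t⟩ x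
  let G : E → ℝ := fun x => ∫ t, Metric.infDist x (F t) ^ 2 ∂ν
  have hGc : Continuous G := continuous_integral_infDist_sq hF hz
  have hG0 : ∀ x, 0 ≤ G x := fun x => integral_nonneg fun t => by positivity
  have hGz : G z = 0 := by
    simp only [G, Metric.infDist_zero_of_mem (hz _)]
    simp
  -- In `C + 1`, the `C` absorbs the quadratic error in `hv`, and the extra `1` gives coercivity and
  -- forces the limit of minimizers to be `z`.
  let f : ℕ → E → ℝ := fun k x => -⟪v, x - z⟫_ℝ + (C + 1) * ‖x - z‖ ^ 2 + (k + 1 : ℝ) * G x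
  have hfc : ∀ k, Continuous (f k) := fun k => by fun_prop
  have hfz : ∀ k, f k z = 0 := fun k => by simp [f, hGz]
  have hball : ∀ k x, f k x ≤ 0 → ‖x - z‖ ≤ ‖v‖ := by
    intro k x hx
    have h1 := real_inner_le_norm v (x - z)
    have h2 := mul_nonneg (by positivity : (0 : ℝ) ≤ k + 1) (hG0 x)
    have h3 := mul_nonneg hC (sq_nonneg ‖x - z‖)
    simp only [f] at hx
    by_contra! h
    nlinarith [norm_nonneg v]
  have hmin : ∀ k, ∃ x, ∀ y, f k x ≤ f k y := by
    intro k
    obtain ⟨x, -, hx⟩ := (isCompact_closedBall z ‖v‖).exists_isMinOn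
      ⟨z, Metric.mem_closedBall_self (norm_nonneg v)⟩ (hfc k).continuousOn
    have hx' : ∀ y ∈ Metric.closedBall z ‖v‖, f k x ≤ f k y := hx
    refine ⟨x, fun y => ?_⟩
    rcases le_or_gt (f k y) 0 with h | h
    · exact hx' y (by rw [Metric.mem_closedBall, dist_eq_norm]; exact hball k y h)
    · have := hx' z (Metric.mem_closedBall_self (norm_nonneg v))
      rw [hfz] at this
      linarith
  choose x hx using hmin
  have hx0 : ∀ k, f k (x k) ≤ 0 := fun k => (hx k z).trans_eq (hfz k)
  -- Stationarity at `x k`: solving the minimality inequality for `G` gives the quadratic minorant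
  -- required of the residuals.
  have hmem : ∀ k, v - (2 * (C + 1)) • (x k - z) ∈ aumannIntegral N ν := by
    intro k
    have hk : (0 : ℝ) < k + 1 := by positivity
    choose y hy hxy using hproj (x k)
    have := integrable_residual_and_integral_eq (ν := ν) hF hz hy hxy
      (a := (2 * ((k : ℝ) + 1))⁻¹ • (v - (2 * (C + 1)) • (x k - z))) (C := (C + 1) / (k + 1)) ?_
    · refine ⟨fun t => (2 * ((k : ℝ) + 1)) • (x k - y t), this.1.smul _,
        Eventually.of_forall fun t => hN t _ _ (hy t) (hxy t) _ (by positivity), ?_⟩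
      rw [integral_smul, this.2, smul_inv_smul₀ (by positivity)]
    · intro d
      have h := hx k (x k + d)
      simp only [f] at h
      rw [add_sub_right_comm, norm_add_sq_real, inner_add_right] at h
      rw [real_inner_smul_right, inner_sub_right, real_inner_smul_right, real_inner_comm v d,
        real_inner_comm (x k - z) d]
      have h' : ((⟪v, d⟫_ℝ - 2 * (C + 1) * ⟪x k - z, d⟫_ℝ) - (C + 1) * ‖d‖ ^ 2) / (k + 1)
          ≤ G (x k + d) - G (x k) := by
        rw [div_le_iff₀ hk]
        linarith
      have h2 : ((⟪v, d⟫_ℝ - 2 * (C + 1) * ⟪x k - z, d⟫_ℝ) - (C + 1) * ‖d‖ ^ 2) / (k + 1) =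
          2 * ((2 * ((k : ℝ) + 1))⁻¹ * (⟪v, d⟫_ℝ - 2 * (C + 1) * ⟪x k - z, d⟫_ℝ))
            - (C + 1) / (k + 1) * ‖d‖ ^ 2 := by
        field_simp
      rw [h2] at h'
      simp only [G] at h'
      linarith
  obtain ⟨w, -, φ, hφ, hw⟩ := (isCompact_closedBall z ‖v‖).tendsto_subseq (x := x) fun k => by
    rw [Metric.mem_closedBall, dist_eq_norm]
    exact hball k _ (hx0 k)
  have hGw : G w = 0 := by
    refine le_antisymm ?_ (hG0 w)
    have h1 : Tendsto (fun k => G (x (φ k))) atTop (𝓝 (G w)) := (hGc.tendsto w).comp hw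
    -- `f ≤ 0` at the minimizer gives `G ≤ ‖v‖² / (k + 1)`.
    have h2 : Tendsto (fun k => (1 / ((φ k : ℝ) + 1)) * (‖v‖ * ‖v‖)) atTop (𝓝 0) := by
      simpa using (tendsto_one_div_add_atTop_nhds_zero_nat (𝕜 := ℝ) |>.comp hφ.tendsto_atTop).mul_const
        (‖v‖ * ‖v‖)
    refine le_of_tendsto_of_tendsto' h1 h2 fun k => ?_
    have h := hx0 (φ k)
    have hb := hball _ _ h
    have hi := real_inner_le_norm v (x (φ k) - z)
    simp only [f] at h
    rw [one_div, inv_mul_eq_div, le_div_iff₀ (by positivity)]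
    nlinarith [norm_nonneg v, mul_nonneg (by linarith : 0 ≤ C + 1) (sq_nonneg ‖x (φ k) - z‖)]
  have hwF : ∀ᵐ t ∂ν, w ∈ F t := by
    have := (integral_eq_zero_iff_of_nonneg (fun t => by positivity)
      (integrable_infDist_sq hF hz w)).1 hGw
    filter_upwards [this] with t ht
    have ht' : Metric.infDist w (F t) = 0 := by simpa using ht
    exact ((hFc t).mem_iff_infDist_zero ⟨z, hz t⟩).2 ht'
  -- In the limit `(C + 1)‖w - z‖² ≤ ⟪v, w - z⟫ ≤ C‖w - z‖²`.
  have hwz : w = z := by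
    have h1 := hv w hwF
    have h2 : -⟪v, w - z⟫_ℝ + (C + 1) * ‖w - z‖ ^ 2 ≤ 0 := by
      have hc : Continuous fun x => -⟪v, x - z⟫_ℝ + (C + 1) * ‖x - z‖ ^ 2 := by fun_prop
      refine le_of_tendsto' ((hc.tendsto w).comp hw) fun k => ?_
      have h := hx0 (φ k)
      simp only [f] at h
      have := mul_nonneg (by positivity : (0 : ℝ) ≤ φ k + 1) (hG0 (x (φ k)))
      simp only [Function.comp]
      linarith
    have h3 : ‖w - z‖ ^ 2 ≤ 0 := by linarith
    have h4 : ‖w - z‖ = 0 := by nlinarith [norm_nonneg (w - z)]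
    exact sub_eq_zero.1 (norm_eq_zero.1 h4)
  subst hwz
  have hlim : Tendsto (fun k => v - (2 * (C + 1)) • (x (φ k) - w)) atTop
      (𝓝 (v - (2 * (C + 1)) • (w - w))) := ((hw.sub_const w).const_smul _).const_sub v
  rw [sub_self, smul_zero, sub_zero] at hlim
  exact mem_closure_of_tendsto hlim (Eventually.of_forall fun k => hmem (φ k))

end Projection

/-! ### Normal cones, contingent cones and proximal normals -/

section NormalCones

variable {E : Type*} [NormedAddCommGroup E] [InnerProductSpace ℝ E]

theorem mem_regularNormalCone_of_le_sq {x v : E} {Θ : Set E} {C : ℝ}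
    (h : ∀ᶠ y in 𝓝[Θ] x, ⟪v, y - x⟫_ℝ ≤ C * ‖y - x‖ ^ 2) : v ∈ regularNormalCone x Θ := by
  intro ε hε
  have h1 : Tendsto (fun y => C * ‖y - x‖) (𝓝[Θ] x) (𝓝 0) := by
    have : Continuous fun y : E => C * ‖y - x‖ := by fun_prop
    simpa using (this.tendsto x).mono_left nhdsWithin_le_nhds
  filter_upwards [h, h1.eventually_lt_const hε] with y hy hy'
  nlinarith [norm_nonneg (y - x)]

theorem smul_mem_regularNormalCone {x v : E} {Θ : Set E} (hv : v ∈ regularNormalCone x Θ)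
    {c : ℝ} (hc : 0 < c) : c • v ∈ regularNormalCone x Θ := by
  intro ε hε
  filter_upwards [hv (ε / c) (by positivity)] with y hy
  rw [real_inner_smul_left]
  calc c * ⟪v, y - x⟫_ℝ ≤ c * (ε / c * ‖y - x‖) := by gcongr
    _ = ε * ‖y - x‖ := by field_simp

theorem mem_normalCone_of_tendsto {x v : E} {Θ : Set E} {y w : ℕ → E} (hyΘ : ∀ k, y k ∈ Θ)
    (hy : Tendsto y atTop (𝓝 x)) (hw : Tendsto w atTop (𝓝 v))
    (h : ∀ k, w k ∈ regularNormalCone (y k) Θ) : v ∈ normalCone x Θ :=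
  ⟨y, w, tendsto_nhdsWithin_iff.2 ⟨hy, Eventually.of_forall hyΘ⟩, hw, h⟩

theorem smul_mem_normalCone {x v : E} {Θ : Set E} (hv : v ∈ normalCone x Θ) {c : ℝ} (hc : 0 < c) :
    c • v ∈ normalCone x Θ := by
  obtain ⟨y, w, hy, hw, h⟩ := hv
  exact ⟨y, fun k => c • w k, hy, hw.const_smul c, fun k => smul_mem_regularNormalCone (h k) hc⟩

theorem sub_mem_regularNormalCone_of_infDist_eq {x y : E} {Θ : Set E}
    (hxy : Metric.infDist x Θ = ‖x - y‖) : x - y ∈ regularNormalCone y Θ := by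
  refine mem_regularNormalCone_of_le_sq (C := 1 / 2) ?_
  filter_upwards [self_mem_nhdsWithin] with p hp
  have h1 : ‖x - y‖ ≤ ‖(x - y) - (p - y)‖ := by
    rw [← hxy, sub_sub_sub_cancel_right, ← dist_eq_norm]
    exact Metric.infDist_le_dist_of_mem hp
  have h2 := pow_le_pow_left₀ (norm_nonneg _) h1 2
  rw [norm_sub_sq_real (x - y)] at h2
  linarith

/-- Projection onto a cone commutes with positive scaling, so `x - y` is a regular normal at every
`s • y`; let `s ↓ 0`. -/
theorem smul_sub_mem_normalCone_zero_of_isCone {K : Set E} (hK : IsCone K) {x y : E} (hy : y ∈ K)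
    (hxy : Metric.infDist x K = ‖x - y‖) {c : ℝ} (hc : 0 < c) : c • (x - y) ∈ normalCone 0 K := by
  refine smul_mem_normalCone ?_ hc
  let s : ℕ → ℝ := fun m => 1 / ((m : ℝ) + 1)
  have hs : ∀ m, 0 < s m := fun m => by positivity
  refine mem_normalCone_of_tendsto (y := fun m => s m • y) (fun m => hK y hy _ (hs m)) ?_
    tendsto_const_nhds fun m => ?_
  · simpa [s] using (tendsto_one_div_add_atTop_nhds_zero_nat (𝕜 := ℝ)).smul_const y
  · have h : Metric.infDist (s m • x) K = ‖s m • x - s m • y‖ := by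
      rw [← smul_sub, norm_smul, Real.norm_of_nonneg (hs m).le, ← hxy]
      refine le_antisymm ?_ ?_
      · have := Metric.infDist_le_dist_of_mem (x := s m • x) (hK y hy _ (hs m))
        rwa [dist_eq_norm, ← smul_sub, norm_smul, Real.norm_of_nonneg (hs m).le, ← hxy] at this
      · refine (Metric.le_infDist ⟨y, hy⟩).2 fun p hp => ?_
        have := Metric.infDist_le_dist_of_mem (x := x) (hK p hp _ (inv_pos.2 (hs m)))
        have h' : dist (s m • x) p = s m * dist x ((s m)⁻¹ • p) := by
          rw [dist_eq_norm, dist_eq_norm, ← abs_of_pos (hs m), ← Real.norm_eq_abs, ← norm_smul,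
            Real.norm_eq_abs, abs_of_pos (hs m), smul_sub, smul_inv_smul₀ (hs m).ne']
        rw [h']
        gcongr
    have h2 := smul_mem_regularNormalCone (sub_mem_regularNormalCone_of_infDist_eq h)
      (inv_pos.2 (hs m))
    rwa [← smul_sub, inv_smul_smul₀ (hs m).ne'] at h2

theorem inner_le_zero_of_mem_regularNormalCone {x v w : E} {Θ : Set E}
    (hv : v ∈ regularNormalCone x Θ) (hw : w ∈ tangentCone x Θ) : ⟪v, w⟫_ℝ ≤ 0 := by
  obtain ⟨τ, u, hτ, hu, hm⟩ := hw
  rw [tendsto_nhdsWithin_iff] at hτ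
  have hx : Tendsto (fun k => x + τ k • u k) atTop (𝓝[Θ] x) := by
    refine tendsto_nhdsWithin_iff.2 ⟨?_, Eventually.of_forall hm⟩
    simpa using (hτ.1.smul hu).const_add x
  have key : ∀ ε : ℝ, 0 < ε → ⟪v, w⟫_ℝ ≤ ε * ‖w‖ := by
    intro ε hε
    have hi : Tendsto (fun k => ⟪v, u k⟫_ℝ) atTop (𝓝 ⟪v, w⟫_ℝ) := tendsto_const_nhds.inner hu
    refine le_of_tendsto_of_tendsto hi (hu.norm.const_mul ε) ?_
    filter_upwards [hx.eventually (hv ε hε), hτ.2] with k hk hτk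
    have hτk' : 0 < τ k := hτk
    rw [add_sub_cancel_left, real_inner_smul_right, norm_smul, Real.norm_of_nonneg hτk'.le] at hk
    refine le_of_mul_le_mul_left ?_ hτk'
    linarith
  have h0 : Tendsto (fun ε : ℝ => ε * ‖w‖) (𝓝[>] 0) (𝓝 0) := by
    have : Continuous fun ε : ℝ => ε * ‖w‖ := by fun_prop
    simpa using (this.tendsto 0).mono_left nhdsWithin_le_nhds
  exact ge_of_tendsto h0 (by filter_upwards [self_mem_nhdsWithin] with ε hε using key ε hε)

theorem mem_tangentCone_iff_frequently {x w : E} {Θ : Set E} :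
    w ∈ tangentCone x Θ ↔
      ∀ ε : ℝ, 0 < ε → ∃ τ : ℝ, 0 < τ ∧ τ < ε ∧ ∃ u, x + τ • u ∈ Θ ∧ ‖u - w‖ < ε := by
  constructor
  · rintro ⟨τ, u, hτ, hu, hm⟩ ε hε
    rw [tendsto_nhdsWithin_iff] at hτ
    obtain ⟨k, h1, h2, h3⟩ := ((hτ.1.eventually_lt_const hε).and
      (hτ.2.and (hu.eventually (Metric.ball_mem_nhds w hε)))).exists
    exact ⟨τ k, h2, h1, u k, hm k, by rwa [← dist_eq_norm]⟩
  · intro h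
    choose τ h1 h2 u h3 h4 using fun k : ℕ => h (1 / ((k : ℝ) + 1)) (by positivity)
    refine ⟨τ, u, tendsto_nhdsWithin_iff.2 ⟨?_, Eventually.of_forall h1⟩, ?_, h3⟩
    · exact squeeze_zero (fun k => (h1 k).le) (fun k => (h2 k).le)
        tendsto_one_div_add_atTop_nhds_zero_nat
    · exact tendsto_iff_norm_sub_tendsto_zero.2 (squeeze_zero (fun k => norm_nonneg _)
        (fun k => (h4 k).le) tendsto_one_div_add_atTop_nhds_zero_nat)

theorem isClosed_tangentCone (x : E) (Θ : Set E) : IsClosed (tangentCone x Θ) := by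
  refine isClosed_of_closure_subset fun w hw => mem_tangentCone_iff_frequently.2 fun ε hε => ?_
  obtain ⟨w', hw', hd⟩ := Metric.mem_closure_iff.1 hw (ε / 2) (by positivity)
  obtain ⟨τ, h1, h2, u, h3, h4⟩ := mem_tangentCone_iff_frequently.1 hw' (ε / 2) (by positivity)
  refine ⟨τ, h1, by linarith, u, h3, ?_⟩
  rw [← dist_eq_norm] at h4 ⊢
  have := dist_triangle u w' w
  rw [dist_comm] at hd
  linarith

theorem zero_mem_tangentCone {x : E} {Θ : Set E} (hx : x ∈ Θ) : (0 : E) ∈ tangentCone x Θ :=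
  mem_tangentCone_iff_frequently.2 fun ε hε =>
    ⟨ε / 2, by positivity, by linarith, 0, by simpa using hx, by simpa using hε⟩

theorem exists_mem_tangentCone_of_bounded [ProperSpace E] {x : E} {Θ : Set E} {τ : ℕ → ℝ}
    {u : ℕ → E} {p : E} {r : ℝ} (hτ : Tendsto τ atTop (𝓝[>] 0)) (hm : ∀ k, x + τ k • u k ∈ Θ)
    (hr : ∀ k, ‖p - u k‖ ≤ r) :
    ∃ w ∈ tangentCone x Θ, ∃ φ : ℕ → ℕ, StrictMono φ ∧ Tendsto (u ∘ φ) atTop (𝓝 w) := by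
  obtain ⟨w, -, φ, hφ, hw⟩ := (isCompact_closedBall p r).tendsto_subseq (x := u) fun k => by
    rw [Metric.mem_closedBall, dist_eq_norm, norm_sub_rev]
    exact hr k
  exact ⟨w, ⟨τ ∘ φ, u ∘ φ, hτ.comp hφ.tendsto_atTop, hw, fun k => hm (φ k)⟩, φ, hφ, hw⟩

/-- Proximal normals to the contingent cone are limiting normals to the set. -/
theorem smul_sub_mem_normalCone_of_infDist_tangentCone [FiniteDimensional ℝ E] {x₀ : E} {Θ : Set E}
    (hΘ : IsClosed Θ) {x y : E} (hy : y ∈ tangentCone x₀ Θ)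
    (hxy : Metric.infDist x (tangentCone x₀ Θ) = ‖x - y‖) {c : ℝ} (hc : 0 < c) :
    c • (x - y) ∈ normalCone x₀ Θ := by
  have : ProperSpace E := FiniteDimensional.proper ℝ E
  obtain ⟨τ, u, hτ, hu, hm⟩ := id hy
  have hpos := (tendsto_nhdsWithin_iff.1 hτ).2
  obtain ⟨K, hK⟩ := eventually_atTop.1 hpos
  replace hτ := hτ.comp (tendsto_add_atTop_nat K)
  replace hu := hu.comp (tendsto_add_atTop_nat K)
  replace hm : ∀ k, x₀ + τ (k + K) • u (k + K) ∈ Θ := fun k => hm _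
  have hpos : ∀ k, 0 < τ (k + K) := fun k => hK _ (by omega)
  clear hK
  -- `y` may not be the only projection of `x`, but it is the only projection of the midpoint `p`.
  -- This identifies the limit of the rescaled projections of `x₀ + τ • p` onto `Θ`.
  set p : E := (1 / 2 : ℝ) • (x + y) with hp
  have hproj : ∀ k, ∃ r : E, x₀ + τ (k + K) • r ∈ Θ ∧
      Metric.infDist (x₀ + τ (k + K) • p) Θ = ‖τ (k + K) • (p - r)‖ := by
    intro k
    obtain ⟨q, hq, hqd⟩ := hΘ.exists_infDist_eq_dist ⟨_, hm k⟩ (x₀ + τ (k + K) • p)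
    have e : τ (k + K) • ((τ (k + K))⁻¹ • (q - x₀)) = q - x₀ := smul_inv_smul₀ (hpos k).ne' _
    refine ⟨(τ (k + K))⁻¹ • (q - x₀), ?_, ?_⟩
    · rw [e, add_sub_cancel]
      exact hq
    · rw [hqd, smul_sub, e, dist_eq_norm]
      congr 1
      abel
  choose r hrΘ hrd using hproj
  have hle : ∀ k, ‖p - r k‖ ≤ ‖p - u (k + K)‖ := by
    intro k
    have h := Metric.infDist_le_dist_of_mem (x := x₀ + τ (k + K) • p) (hm k)
    rw [hrd, dist_eq_norm, add_sub_add_left_eq_sub, ← smul_sub, norm_smul, norm_smul,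
      Real.norm_of_nonneg (hpos k).le] at h
    exact le_of_mul_le_mul_left h (hpos k)
  have hlim : Tendsto (fun k => ‖p - u (k + K)‖) atTop (𝓝 ‖p - y‖) := (hu.const_sub p).norm
  obtain ⟨b, hb⟩ := hlim.bddAbove_range
  obtain ⟨w, hwT, φ, hφ, hw⟩ := exists_mem_tangentCone_of_bounded hτ hrΘ
    fun k => (hle k).trans (hb ⟨k, rfl⟩)
  -- The closed ball about `p` through `y` meets the complement of the open ball about `x` through
  -- `y` only at `y`.
  have hwy : w = y := by
    have h1 : ‖p - w‖ ≤ ‖p - y‖ := le_of_tendsto_of_tendsto' (hw.const_sub p).norm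
      (hlim.comp hφ.tendsto_atTop) fun k => hle (φ k)
    have h2 : ‖x - y‖ ≤ ‖x - w‖ := by
      rw [← hxy, ← dist_eq_norm]
      exact Metric.infDist_le_dist_of_mem hwT
    have e1 : p - w = (1 / 2 : ℝ) • (x - y) - (w - y) := by rw [hp]; module
    have e2 : p - y = (1 / 2 : ℝ) • (x - y) := by rw [hp]; module
    have e3 : x - w = (x - y) - (w - y) := by abel
    have h1' := pow_le_pow_left₀ (norm_nonneg _) h1 2
    have h2' := pow_le_pow_left₀ (norm_nonneg _) h2 2
    rw [e1, e2, norm_sub_sq_real, real_inner_smul_left] at h1'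
    rw [e3, norm_sub_sq_real (x - y)] at h2'
    have h4 : ‖w - y‖ = 0 := by nlinarith [norm_nonneg (w - y)]
    exact sub_eq_zero.1 (norm_eq_zero.1 h4)
  subst hwy
  have hhalf : p - w ∈ normalCone x₀ Θ := by
    refine mem_normalCone_of_tendsto (y := fun k => x₀ + τ (φ k + K) • r (φ k))
      (w := fun k => p - r (φ k)) (fun k => hrΘ _) ?_ (hw.const_sub p) fun k => ?_
    · have := (tendsto_nhdsWithin_iff.1 (hτ.comp hφ.tendsto_atTop)).1.smul hw
      simpa using this.const_add x₀
    · have e : x₀ + τ (φ k + K) • p - (x₀ + τ (φ k + K) • r (φ k)) =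
          τ (φ k + K) • (p - r (φ k)) := by rw [add_sub_add_left_eq_sub, smul_sub]
      have h := smul_mem_regularNormalCone (sub_mem_regularNormalCone_of_infDist_eq
        (x := x₀ + τ (φ k + K) • p) (y := x₀ + τ (φ k + K) • r (φ k)) (Θ := Θ)
        (by rw [e]; exact hrd (φ k))) (inv_pos.2 (hpos (φ k)))
      rwa [e, inv_smul_smul₀ (hpos (φ k)).ne'] at h
  have e : c • (x - w) = (2 * c) • (p - w) := by rw [hp]; module
  rw [e]
  exact smul_mem_normalCone hhalf (by positivity)

end NormalCones

/-! ### Measurability of distance functions -/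

section Measurability

variable {E : Type*} [NormedAddCommGroup E] {T : Type*}

/-- The distance is lower semicontinuous in `t`: nearest points along a sequence in a sublevel set
subconverge, and outer semicontinuity keeps the limit in `M s`. -/
theorem measurable_infDist_of_isOuterSemicontinuous [ProperSpace E] [MetricSpace T]
    [MeasurableSpace T] [BorelSpace T] {M : T → Set E} (hc : ∀ t, IsClosed (M t))
    (hne : ∀ t, (M t).Nonempty) (hM : IsOuterSemicontinuous M) (x : E) :
    Measurable fun t => Metric.infDist x (M t) := by
  refine measurable_of_Iic fun a => IsClosed.measurableSet (IsSeqClosed.isClosed ?_)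
  intro t s ht hts
  choose y hy hyd using fun k => (hc (t k)).exists_infDist_eq_dist (hne (t k)) x
  have hya : ∀ k, dist x (y k) ≤ a := fun k => (hyd k).symm.trans_le (ht k)
  obtain ⟨w, -, φ, hφ, hw⟩ := (isCompact_closedBall x a).tendsto_subseq (x := y) fun k => by
    rw [Metric.mem_closedBall, dist_comm]
    exact hya k
  have hws : w ∈ M s := hM s ⟨t ∘ φ, y ∘ φ, hts.comp hφ.tendsto_atTop, hw, fun k => hy (φ k)⟩
  exact (Metric.infDist_le_dist_of_mem hws).trans
    (le_of_tendsto' (tendsto_const_nhds.dist hw) fun k => hya (φ k))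

/-- Only countably many step sizes are involved, which yields measurability in `t`. Rational steps
suffice because the strict inequality is open in the step; the converse is compactness. -/
theorem infDist_tangentCone_le_iff [InnerProductSpace ℝ E] [ProperSpace E] {x₀ x : E} {Θ : Set E}
    (hx₀ : x₀ ∈ Θ) {a : ℝ} :
    Metric.infDist x (tangentCone x₀ Θ) ≤ a ↔
      ∀ m : ℕ, ∃ q : ℚ, 0 < (q : ℝ) ∧ (q : ℝ) < 1 / ((m : ℝ) + 1) ∧
        Metric.infDist (x₀ + (q : ℝ) • x) Θ < q * (a + 1 / ((m : ℝ) + 1)) := by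
  have hne : (tangentCone x₀ Θ).Nonempty := ⟨0, zero_mem_tangentCone hx₀⟩
  constructor
  · intro h m
    have hδ : (0 : ℝ) < 1 / ((m : ℝ) + 1) := by positivity
    set δ : ℝ := 1 / ((m : ℝ) + 1)
    obtain ⟨y, hy, hyd⟩ := (Metric.infDist_lt_iff hne).1
      (show Metric.infDist x (tangentCone x₀ Θ) < a + δ / 2 by linarith)
    obtain ⟨τ, h1, h2, u, h3, h4⟩ := mem_tangentCone_iff_frequently.1 hy (δ / 2) (by positivity)
    have hlt : Metric.infDist (x₀ + τ • x) Θ < τ * (a + δ) := by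
      refine (Metric.infDist_le_dist_of_mem h3).trans_lt ?_
      rw [dist_eq_norm, add_sub_add_left_eq_sub, ← smul_sub, norm_smul, Real.norm_of_nonneg h1.le]
      have : ‖x - u‖ < a + δ := by
        rw [← dist_eq_norm] at h4 ⊢
        have := dist_triangle x y u
        rw [dist_comm y u] at this
        linarith
      gcongr
    have hcont : Continuous fun s : ℝ => Metric.infDist (x₀ + s • x) Θ - s * (a + δ) :=
      ((Metric.continuous_infDist_pt Θ).comp (by fun_prop)).sub (by fun_prop)
    have hopen : IsOpen {s : ℝ | Metric.infDist (x₀ + s • x) Θ - s * (a + δ) < 0} :=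
      isOpen_lt hcont continuous_const
    obtain ⟨q, hq⟩ := Rat.denseRange_cast.exists_mem_open (hopen.inter isOpen_Ioo)
      ⟨τ, sub_neg.2 hlt, (⟨h1, by linarith⟩ : τ ∈ Set.Ioo 0 δ)⟩
    exact ⟨q, hq.2.1, hq.2.2, sub_neg.1 hq.1⟩
  · intro h
    choose q h1 h2 h3 using h
    have hp : ∀ m, ∃ u, x₀ + (q m : ℝ) • u ∈ Θ ∧ ‖x - u‖ < a + 1 / ((m : ℝ) + 1) := by
      intro m
      obtain ⟨p, hp, hpd⟩ := (Metric.infDist_lt_iff ⟨x₀, hx₀⟩).1 (h3 m)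
      have e : (q m : ℝ) • ((q m : ℝ)⁻¹ • (p - x₀)) = p - x₀ := smul_inv_smul₀ (h1 m).ne' _
      refine ⟨(q m : ℝ)⁻¹ • (p - x₀), by rwa [e, add_sub_cancel], ?_⟩
      have e2 : dist (x₀ + (q m : ℝ) • x) p = q m * ‖x - (q m : ℝ)⁻¹ • (p - x₀)‖ := by
        have : x₀ + (q m : ℝ) • x - p = (q m : ℝ) • (x - (q m : ℝ)⁻¹ • (p - x₀)) := by
          rw [smul_sub, e]; abel
        rw [dist_eq_norm, this, norm_smul, Real.norm_of_nonneg (h1 m).le]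
      rw [e2] at hpd
      exact lt_of_mul_lt_mul_left hpd (h1 m).le
    choose u hu hud using hp
    have hτ : Tendsto (fun m => (q m : ℝ)) atTop (𝓝[>] 0) :=
      tendsto_nhdsWithin_iff.2 ⟨squeeze_zero (fun m => (h1 m).le) (fun m => (h2 m).le)
        tendsto_one_div_add_atTop_nhds_zero_nat, Eventually.of_forall h1⟩
    obtain ⟨w, hwT, φ, hφ, hw⟩ := exists_mem_tangentCone_of_bounded (p := x) (r := a + 1) hτ hu
      fun m => (hud m).le.trans (by
        have : 1 / ((m : ℝ) + 1) ≤ 1 := by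
          rw [div_le_one (by positivity)]
          linarith [(Nat.cast_nonneg m : (0 : ℝ) ≤ m)]
        linarith)
    refine (Metric.infDist_le_dist_of_mem hwT).trans ?_
    rw [dist_eq_norm]
    have hlim : Tendsto (fun m : ℕ => a + 1 / ((m : ℝ) + 1)) atTop (𝓝 a) := by
      simpa using (tendsto_one_div_add_atTop_nhds_zero_nat (𝕜 := ℝ)).const_add a
    exact le_of_tendsto_of_tendsto' (hw.const_sub x).norm (hlim.comp hφ.tendsto_atTop)
      fun m => (hud (φ m)).le

theorem measurable_infDist_tangentCone [InnerProductSpace ℝ E] [ProperSpace E] [MeasurableSpace T]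
    {M : T → Set E} {x₀ : E} (hx₀ : ∀ t, x₀ ∈ M t)
    (hM : ∀ x, Measurable fun t => Metric.infDist x (M t)) (x : E) :
    Measurable fun t => Metric.infDist x (tangentCone x₀ (M t)) := by
  refine measurable_of_Iic fun a => ?_
  have : (fun t => Metric.infDist x (tangentCone x₀ (M t))) ⁻¹' Set.Iic a =
      ⋂ m : ℕ, ⋃ q : ℚ, {t | 0 < (q : ℝ) ∧ (q : ℝ) < 1 / ((m : ℝ) + 1) ∧
        Metric.infDist (x₀ + (q : ℝ) • x) (M t) < q * (a + 1 / ((m : ℝ) + 1))} := by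
    ext t
    simp only [Set.mem_preimage, Set.mem_Iic, infDist_tangentCone_le_iff (hx₀ t), Set.mem_iInter,
      Set.mem_iUnion, Set.mem_ofPred_eq]
  rw [this]
  refine MeasurableSet.iInter fun m => MeasurableSet.iUnion fun q => ?_
  exact (MeasurableSet.const _).inter ((MeasurableSet.const _).inter
    (measurableSet_lt (hM _) measurable_const))

end Measurability

/-- Outer semicontinuity is applied to a constant sequence of values. -/
theorem biInter_eq_iInter_of_dense {X Y : Type*} [MetricSpace X]
    [TopologicalSpace Y] {M : X → Set Y} (hM : IsOuterSemicontinuous M) {A : Set X} (hA : Dense A) :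
    ⋂ t ∈ A, M t = ⋂ t, M t := by
  refine Set.Subset.antisymm (fun y hy => Set.mem_iInter.2 fun t => ?_)
    (Set.subset_iInter₂ fun t _ => Set.iInter_subset _ t)
  obtain ⟨u, hu, hut⟩ := mem_closure_iff_seq_limit.1 (hA t)
  exact hM t ⟨u, fun _ => y, hut, tendsto_const_nhds, fun k => Set.mem_iInter₂.1 hy _ (hu k)⟩

/-! ### Sum rule at a constrained minimizer, by penalization -/

/-- Decouple the argument of `g` from the point of `Ω` and minimize `g x + κ/2 ‖x - z‖² + ‖z -
x₀‖²/2`. The last term localizes `z`, since `x₀` need not be a strict minimizer. Comparison with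
`(x₀, x₀)` and the Lipschitz bound give an estimate of `κ‖x - z‖` independent of `κ`. -/
theorem exists_penalty_minimizer {E : Type*} [NormedAddCommGroup E] [ProperSpace E] {g : E → ℝ} {K : ℝ≥0} {x₀ : E} {r : ℝ}
    {Ω : Set E} (hr : 0 ≤ r) (hg : LipschitzOnWith K g (Metric.closedBall x₀ r))
    (hΩ : IsClosed Ω) (hx₀ : x₀ ∈ Ω) (hmin : ∀ y ∈ Ω, y ∈ Metric.closedBall x₀ r → g x₀ ≤ g y)
    {κ : ℝ} (hκ : 0 < κ) :
    ∃ x ∈ Metric.closedBall x₀ r, ∃ z ∈ Ω, κ * ‖x - z‖ ≤ 2 * K ∧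
      ‖z - x₀‖ ^ 2 ≤ 2 * K * ‖x - z‖ ∧
      (∀ y ∈ Metric.closedBall x₀ r, g x + κ / 2 * ‖x - z‖ ^ 2 ≤ g y + κ / 2 * ‖y - z‖ ^ 2) ∧
      ∀ q ∈ Ω, q ∈ Metric.closedBall x₀ r →
        κ / 2 * ‖x - z‖ ^ 2 + ‖z - x₀‖ ^ 2 / 2 ≤ κ / 2 * ‖x - q‖ ^ 2 + ‖q - x₀‖ ^ 2 / 2 := by
  have hB := isCompact_closedBall x₀ r
  have hcc : x₀ ∈ Metric.closedBall x₀ r := Metric.mem_closedBall_self hr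
  have hcont : ContinuousOn
      (fun p : E × E => g p.1 + (κ / 2 * ‖p.1 - p.2‖ ^ 2 + ‖p.2 - x₀‖ ^ 2 / 2))
      (Metric.closedBall x₀ r ×ˢ (Metric.closedBall x₀ r ∩ Ω)) := by
    refine ContinuousOn.add ?_ (Continuous.continuousOn (by fun_prop))
    exact hg.continuousOn.comp continuous_fst.continuousOn fun p hp => hp.1
  obtain ⟨⟨x, z⟩, ⟨hx, hzB, hz⟩, hxz⟩ := (hB.prod (hB.inter_right hΩ)).exists_isMinOn
    ⟨(x₀, x₀), hcc, hcc, hx₀⟩ hcont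
  have H : ∀ y ∈ Metric.closedBall x₀ r, ∀ q ∈ Ω, q ∈ Metric.closedBall x₀ r →
      g x + (κ / 2 * ‖x - z‖ ^ 2 + ‖z - x₀‖ ^ 2 / 2) ≤
        g y + (κ / 2 * ‖y - q‖ ^ 2 + ‖q - x₀‖ ^ 2 / 2) :=
    fun y hy q hq hqB => hxz (show (y, q) ∈ _ from ⟨hy, hqB, hq⟩)
  have h0 := H x₀ hcc x₀ hx₀ hcc
  simp only [sub_self, norm_zero] at h0
  have h1 : g z - g x ≤ K * ‖x - z‖ := by
    have := hg.dist_le_mul z hzB x hx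
    rw [Real.dist_eq, dist_comm, dist_eq_norm] at this
    exact (le_abs_self _).trans this
  have h2 := hmin z hz hzB
  refine ⟨x, hx, z, hz, ?_, ?_, fun y hy => ?_, fun q hq hqB => ?_⟩
  · by_contra! hlt
    have hpos : 0 < ‖x - z‖ := by
      refine (norm_nonneg _).lt_of_ne fun h => ?_
      rw [← h, mul_zero] at hlt
      exact absurd hlt (not_lt.2 (by positivity))
    nlinarith [sq_nonneg ‖z - x₀‖]
  · nlinarith [mul_nonneg hκ.le (sq_nonneg ‖x - z‖)]
  · linarith [H y hy z hz hzB]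
  · linarith [H x hx q hq hqB]

section SumRule

variable {E : Type*} [NormedAddCommGroup E] [InnerProductSpace ℝ E]

/-- A quadratic minorant at `x` yields a regular normal to the epigraph. -/
theorem toLp_mem_regularNormalCone_epigraph {h : E → WithTop ℝ} {x w : E} {α C : ℝ}
    (hw : ∀ᶠ y in 𝓝 x, ∀ β : ℝ, h y ≤ β → α + ⟪w, y - x⟫_ℝ - C * ‖y - x‖ ^ 2 ≤ β) (hC : 0 ≤ C) :
    WithLp.toLp 2 (w, (-1 : ℝ)) ∈ regularNormalCone (WithLp.toLp 2 (x, α)) (epigraph h) := by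
  refine mem_regularNormalCone_of_le_sq (C := C) ?_
  have hfst : Tendsto (fun p : WithLp 2 (E × ℝ) => p.fst)
      (𝓝[epigraph h] (WithLp.toLp 2 (x, α))) (𝓝 x) := by
    have : Continuous fun p : WithLp 2 (E × ℝ) => p.fst := by fun_prop
    exact (this.tendsto (WithLp.toLp 2 (x, α))).mono_left nhdsWithin_le_nhds
  filter_upwards [hfst.eventually hw, self_mem_nhdsWithin] with p hp hpe
  have h1 := hp p.snd hpe
  have h2 := WithLp.prod_norm_sq_eq_of_L2 (p - WithLp.toLp 2 (x, α))
  have h3 : ⟪WithLp.toLp 2 (w, (-1 : ℝ)), p - WithLp.toLp 2 (x, α)⟫_ℝ =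
      ⟪w, p.fst - x⟫_ℝ - (p.snd - α) := by
    rw [WithLp.prod_inner_apply]
    simp [sub_eq_add_neg]
  have h4 : (p - WithLp.toLp 2 (x, α)).fst = p.fst - x := rfl
  rw [h4] at h2
  rw [h3, h2]
  nlinarith [mul_nonneg hC (sq_nonneg ‖(p - WithLp.toLp 2 (x, α)).snd‖)]

/-- Minimality in `x` gives the subgradient `w = -κ(x - z)`, minimality in `z` the proximal normal
`u = κ(x - z) - (z - x₀)`; their sum is `-(z - x₀)`. The proximal inequality is stated on all of
`Ω`, as the integral representation requires. -/
theorem exists_approximate_multiplier [ProperSpace E] {h : E → WithTop ℝ} {g : E → ℝ} {K : ℝ≥0}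
    {x₀ : E} {r : ℝ} {Ω : Set E} (hr : 0 < r) (hg : LipschitzOnWith K g (Metric.closedBall x₀ r))
    (hhg : ∀ y ∈ Metric.closedBall x₀ r, h y = (g y : WithTop ℝ))
    (hΩ : IsClosed Ω) (hx₀ : x₀ ∈ Ω) (hmin : ∀ y ∈ Ω, y ∈ Metric.closedBall x₀ r → g x₀ ≤ g y)
    {ε : ℝ} (hε : 0 < ε) :
    ∃ x z w u : E, ‖x - x₀‖ < ε ∧ x ∈ Metric.closedBall x₀ r ∧ z ∈ Ω ∧ ‖z - x₀‖ < ε ∧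
      ‖w‖ ≤ 2 * K ∧ ‖w + u‖ < ε ∧
      WithLp.toLp 2 (w, (-1 : ℝ)) ∈ regularNormalCone (WithLp.toLp 2 (x, g x)) (epigraph h) ∧
      ∃ C, 0 ≤ C ∧ ∀ q ∈ Ω, ⟪u, q - z⟫_ℝ ≤ C * ‖q - z‖ ^ 2 := by
  set η : ℝ := min ε r / 2 with hη
  have hη0 : 0 < η := by positivity
  have hηε : 2 * η ≤ ε := by rw [hη]; linarith [min_le_left ε r]
  have hηr : 2 * η ≤ r := by rw [hη]; linarith [min_le_right ε r]
  -- With `κ = (2K + 1)/δ`, the penalty bounds become `‖x - z‖ < δ ≤ η` and `‖z - x₀‖² ≤ 2Kδ < η²`.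
  set δ : ℝ := min η (η ^ 2 / (2 * K + 1)) with hδ
  have hδ0 : 0 < δ := by positivity
  obtain ⟨x, hx, z, hz, h1, h2, h3, h4⟩ := exists_penalty_minimizer hr.le hg hΩ hx₀ hmin
    (κ := (2 * K + 1) / δ) (by positivity)
  have hκ : 0 < (2 * K + 1) / δ := by positivity
  have hxzδ : ‖x - z‖ < δ := by
    rw [div_mul_eq_mul_div, div_le_iff₀ hδ0] at h1
    have : (0 : ℝ) ≤ K := K.2
    by_contra! hlt
    nlinarith
  set κ : ℝ := (2 * K + 1) / δ
  have hxzη : ‖x - z‖ < η := hxzδ.trans_le (min_le_left _ _)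
  have hzx : ‖z - x₀‖ < η := by
    have h5 : δ * (2 * K + 1) ≤ η ^ 2 := by
      rw [← le_div_iff₀ (by positivity)]
      exact min_le_right _ _
    have : (0 : ℝ) ≤ K := K.2
    refine lt_of_pow_lt_pow_left₀ 2 hη0.le ?_
    nlinarith [norm_nonneg (x - z)]
  have hxx : ‖x - x₀‖ < 2 * η := by
    have := norm_sub_le_norm_sub_add_norm_sub x z x₀
    linarith
  refine ⟨x, z, -(κ • (x - z)), κ • (x - z) - (z - x₀), by linarith, hx, hz, by linarith, ?_, ?_,
    ?_, ?_⟩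
  · rwa [norm_neg, norm_smul, Real.norm_of_nonneg hκ.le]
  · rw [neg_add_eq_sub, sub_sub_cancel_left, norm_neg]
    linarith
  · refine toLp_mem_regularNormalCone_epigraph (C := κ / 2) ?_ (by positivity)
    filter_upwards [Metric.isOpen_ball.mem_nhds (show x ∈ Metric.ball x₀ r by
      rw [Metric.mem_ball, dist_eq_norm]; linarith)] with y hy β hβ
    have hyB := Metric.ball_subset_closedBall hy
    rw [hhg y hyB, WithTop.coe_le_coe] at hβ
    have h5 := h3 y hyB
    rw [← sub_add_sub_cancel y x z, norm_add_sq_real, real_inner_comm] at h5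
    rw [inner_neg_left, real_inner_smul_left]
    linarith
  · set u : E := κ • (x - z) - (z - x₀) with hu
    -- The first term serves `q` in the ball. Outside it `‖q - z‖ ≥ r / 2`, and the second term
    -- dominates the Cauchy–Schwarz bound.
    refine ⟨(κ + 1) / 2 + ‖u‖ * (2 / r), by positivity, fun q hq => ?_⟩
    by_cases hqB : q ∈ Metric.closedBall x₀ r
    · have h5 := h4 q hq hqB
      rw [← sub_sub_sub_cancel_right x q z, ← sub_add_sub_cancel q z x₀, norm_sub_sq_real (x - z),
        norm_add_sq_real (q - z), real_inner_comm (z - x₀) (q - z)] at h5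
      have h6 : 0 ≤ ‖u‖ * (2 / r) * ‖q - z‖ ^ 2 := by positivity
      rw [hu, inner_sub_left, real_inner_smul_left]
      nlinarith
    · have h5 : r / 2 ≤ ‖q - z‖ := by
        rw [Metric.mem_closedBall, dist_eq_norm, not_le] at hqB
        have := norm_sub_le_norm_sub_add_norm_sub q z x₀
        linarith
      have h6 : 1 ≤ 2 / r * ‖q - z‖ := by
        rw [div_mul_eq_mul_div, le_div_iff₀ hr]
        linarith
      calc ⟪u, q - z⟫_ℝ ≤ ‖u‖ * ‖q - z‖ * 1 := by rw [mul_one]; exact real_inner_le_norm _ _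
        _ ≤ ‖u‖ * ‖q - z‖ * (2 / r * ‖q - z‖) := by gcongr
        _ = ‖u‖ * (2 / r) * ‖q - z‖ ^ 2 := by ring
        _ ≤ _ := by
          gcongr
          linarith

/-- The limiting sum rule at a local minimizer over a closed set, with the normal vector realized
as a limit of proximal normals. -/
theorem exists_mem_subdifferential_and_tendsto_proximal_normals [ProperSpace E]
    {h : E → WithTop ℝ} {x₀ : E} {Ω : Set E} (hΩ : IsClosed Ω) (hx₀ : x₀ ∈ Ω)
    (hmin : IsLocalMinOn h Ω x₀) (hLip : IsLipschitzAround h x₀) :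
    ∃ w ∈ subdifferential h x₀, ∃ z u : ℕ → E, (∀ k, z k ∈ Ω) ∧ Tendsto z atTop (𝓝 x₀) ∧
      Tendsto u atTop (𝓝 (-w)) ∧
      ∀ k, ∃ C, 0 ≤ C ∧ ∀ q ∈ Ω, ⟪u k, q - z k⟫_ℝ ≤ C * ‖q - z k‖ ^ 2 := by
  obtain ⟨U, hU, g, K, hg, hhg⟩ := hLip
  obtain ⟨V, hV, hVmin⟩ := mem_nhdsWithin_iff_exists_mem_nhds_inter.1 hmin
  obtain ⟨r, hr, hrUV⟩ := Metric.nhds_basis_closedBall.mem_iff.1 (inter_mem hU hV)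
  have hhg' : ∀ y ∈ Metric.closedBall x₀ r, h y = (g y : WithTop ℝ) :=
    fun y hy => hhg y (hrUV hy).1
  have hmin' : ∀ y ∈ Ω, y ∈ Metric.closedBall x₀ r → g x₀ ≤ g y := by
    intro y hy hyB
    have h1 : h x₀ ≤ h y := hVmin ⟨(hrUV hyB).2, hy⟩
    rwa [hhg' y hyB, hhg' x₀ (Metric.mem_closedBall_self hr.le), WithTop.coe_le_coe] at h1
  have hg' := hg.mono fun y hy => (hrUV hy).1
  choose x z w u hx hxB hz hzx hw hwu hN hP using fun k : ℕ =>
    exists_approximate_multiplier hr hg' hhg' hΩ hx₀ hmin' (ε := 1 / ((k : ℝ) + 1)) (by positivity)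
  have hlim : ∀ {a : ℕ → E} {b : E}, (∀ k : ℕ, ‖a k - b‖ < 1 / ((k : ℝ) + 1)) →
      Tendsto a atTop (𝓝 b) := fun h => tendsto_iff_norm_sub_tendsto_zero.2
    (squeeze_zero (fun k => norm_nonneg _) (fun k => (h k).le)
      tendsto_one_div_add_atTop_nhds_zero_nat)
  obtain ⟨w₀, -, φ, hφ, hw₀⟩ := (isCompact_closedBall (0 : E) (2 * K)).tendsto_subseq (x := w)
    fun k => by rw [mem_closedBall_zero_iff]; exact hw k
  have hxlim : Tendsto (x ∘ φ) atTop (𝓝 x₀) := (hlim hx).comp hφ.tendsto_atTop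
  have hulim : Tendsto (u ∘ φ) atTop (𝓝 (-w₀)) := by
    have h1 : Tendsto (fun k => w k + u k) atTop (𝓝 0) := hlim fun k => by simpa using hwu k
    have h2 := (h1.comp hφ.tendsto_atTop).sub hw₀
    simpa [Function.comp_def] using h2
  have hglim : Tendsto (fun k => g (x (φ k))) atTop (𝓝 (g x₀)) := by
    have hc := hg'.continuousOn.continuousAt (Metric.closedBall_mem_nhds x₀ hr)
    exact hc.tendsto.comp hxlim
  refine ⟨w₀, ⟨g x₀, hhg' x₀ (Metric.mem_closedBall_self hr.le), ?_⟩, z ∘ φ, u ∘ φ,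
    fun k => hz _, (hlim hzx).comp hφ.tendsto_atTop, hulim, fun k => hP _⟩
  have hc : Continuous fun p : E × ℝ => WithLp.toLp 2 p := WithLp.prod_continuous_toLp 2 E ℝ
  refine mem_normalCone_of_tendsto (y := fun k => WithLp.toLp 2 (x (φ k), g (x (φ k))))
    (w := fun k => WithLp.toLp 2 (w (φ k), (-1 : ℝ))) (fun k => ?_)
    ((hc.tendsto _).comp (hxlim.prodMk_nhds hglim))
    ((hc.tendsto _).comp (hw₀.prodMk_nhds tendsto_const_nhds)) fun k => hN _
  exact (hhg' _ (hxB _)).le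

end SumRule

end SemiInfinite

/-! ### The optimality conditions -/

open SemiInfinite in
theorem theorem7p1 {n : ℕ} {T : Type*} [MetricSpace T] [MeasurableSpace T] [BorelSpace T]
    (M : T → Set (EuclideanSpace ℝ (Fin n)))
    (hM_closed : ∀ t, IsClosed (M t))
    (hM_osc : IsOuterSemicontinuous M)
    (h : EuclideanSpace ℝ (Fin n) → WithTop ℝ)
    (xbar : EuclideanSpace ℝ (Fin n))
    (hfeas : ∀ t, xbar ∈ M t)
    (hmin : IsLocalMinOn h (⋂ t, M t) xbar)
    (hLip : IsLipschitzAround h xbar) :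
    (IsNormallyRegularAt xbar (⋂ t, M t) →
      (∀ A : Set T, Dense A →
        tangentCone xbar (⋂ t ∈ A, M t) = ⋂ t ∈ A, tangentCone xbar (M t)) →
      ∀ ν : Measure T, IsFiniteMeasure ν → ν.IsOpenPosMeasure →
        (0 : EuclideanSpace ℝ (Fin n)) ∈
          subdifferential h xbar + closure (aumannIntegral (fun t => normalCone xbar (M t)) ν)) ∧
    ((∀ t, IsCone (M t)) → xbar = 0 →
      ∀ ν : Measure T, IsFiniteMeasure ν → ν.IsOpenPosMeasure →
        (0 : EuclideanSpace ℝ (Fin n)) ∈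
          subdifferential h 0 + closure (aumannIntegral (fun t => normalCone 0 (M t)) ν)) := by
  obtain ⟨w, hw, z, u, hz, hzx, hu, hprox⟩ :=
    exists_mem_subdifferential_and_tendsto_proximal_normals (isClosed_iInter hM_closed)
      (Set.mem_iInter.2 hfeas) hmin hLip
  have hmeas := measurable_infDist_of_isOuterSemicontinuous hM_closed (fun t => ⟨_, hfeas t⟩) hM_osc
  refine ⟨fun hreg hchip ν hν hνo => ?_, fun hcone hx ν hν hνo => ?_⟩
  · refine Set.mem_add.2 ⟨w, hw, -w, ?_, add_neg_cancel w⟩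
    have hreg' : -w ∈ regularNormalCone xbar (⋂ t, M t) := by
      rw [hreg]
      refine mem_normalCone_of_tendsto hz hzx hu fun k => ?_
      obtain ⟨C, -, hC⟩ := hprox k
      exact mem_regularNormalCone_of_le_sq
        (by filter_upwards [self_mem_nhdsWithin] with q hq using hC q hq)
    refine mem_closure_aumannIntegral_of_ae_imp (F := fun t => tangentCone xbar (M t)) (z := 0)
      (fun t => isClosed_tangentCone _ _) (measurable_infDist_tangentCone hfeas hmeas)
      (fun t => zero_mem_tangentCone (hfeas t))
      (fun t x y hy hxy c hc =>
        smul_sub_mem_normalCone_of_infDist_tangentCone (hM_closed t) hy hxy hc)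
      le_rfl fun x hx => ?_
    -- The conull index set depends on `x`, which is why CHIP is needed for every dense set.
    have hdense := Measure.dense_of_ae hx
    have hxT : x ∈ tangentCone xbar (⋂ t, M t) := by
      rw [← biInter_eq_iInter_of_dense hM_osc hdense, hchip _ hdense]
      exact Set.mem_iInter₂.2 fun t ht => ht
    simpa using inner_le_zero_of_mem_regularNormalCone hreg' hxT
  · subst hx
    refine Set.mem_add.2 ⟨w, hw, -w, ?_, add_neg_cancel w⟩
    -- Each `u k` is represented at its own base point `z k`; conicity moves all the normals to `0`,
    -- so the closed set is the same for every `k`.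
    refine isClosed_closure.mem_of_tendsto hu (Eventually.of_forall fun k => ?_)
    obtain ⟨C, hC0, hC⟩ := hprox k
    refine mem_closure_aumannIntegral_of_ae_imp hM_closed hmeas
      (fun t => Set.mem_iInter.1 (hz k) t)
      (fun t x y hy hxy c hc => smul_sub_mem_normalCone_zero_of_isCone (hcone t) hy hxy hc)
      hC0 fun x hx => hC x ?_
    rw [← biInter_eq_iInter_of_dense hM_osc (Measure.dense_of_ae hx)]
    exact Set.mem_iInter₂.2 fun t ht => ht
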